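/- Consider a linear chain of $n$ independent sources $\mathcal S_1,\dots,\mathcal S_n$ and $n+1$ parties $A_1,\dots,A_{n+1}$, where $\mathcal S_i$ distributes a bipartite quantum state $\rho_i$ (on finite-dimensional Hilbert spaces) to $A_i$ and $A_{i+1}$. The extreme parties $A_1$, $A_{n+1}$ choose among finitely many POVMs with inputs $x_1$, $x_{n+1}$ and finitely many outcomes each; every intermediate party $A_2,\dots,A_n$ performs one fixed POVM with finitely many outcomes on the two particles it receives. The resulting quantum correlations are $$P(a_1,\dots,a_{n+1}\mid x_1,x_{n+1})=\mathrm{Tr}\Big[\big(M_1^{a_1|x_1}\otimes M_2^{a_2}\otimes\cdots\otimes M_n^{a_n}\otimes M_{n+1}^{a_{n+1}|x_{n+1}}\big)\,(\rho_1\otimes\cdots\otimes\rho_n)\Big].$$ They are $n$-local if there are independent hidden variables $\lambda_i\sim\mu_i$ and response distributions such that $P(a_1,\dots,a_{n+1}|x_1,x_{n+1})$ is the average, over $\mu_1\times\cdots\times\mu_n$, of $$P(a_1|x_1,\lambda_1)\prod_{i=2}^{n}P(a_i|\lambda_{i-1},\lambda_i)\;P(a_{n+1}|x_{n+1},\lambda_n).$$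 A family of POVMs $\{M^{a|x}\}$ is compatible if there are a parent POVM $\{G_\lambda\}$ and conditional distributions $p(a|x,\lambda)$ with $M^{a|x}=\sum_\lambda p(a|x,\lambda)G_\lambda$ for all $a,x$. (1) For every $n\ge 3$ there are two-qubit states $\rho_1,\dots,\rho_n$, two compatible two-outcome measurements for each of $A_1$ and $A_{n+1}$, and a single four-outcome measurement for each of $A_2,\dots,A_n$ (so that every party performs compatible measurements), such that the resulting correlations are not $n$-local, even if hidden variables in arbitrary probability spaces are allowed. (2) For $n=2$, if the measurements of $A_1$ are compatible and those of $A_3$ are compatible, while $A_2$ performs one measurement, then for all states $\rho_1,\rho_2$ the correlations admit a bilocal (that is, $2$-local) model, and one whose hidden variables take finitely many values. -/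

import Mathlib

open scoped ComplexOrder

noncomputable section

namespace NLocal

/-- A density matrix on the Hilbert space with (finite) orthonormal basis `ι`. -/
structure DensityMatrix (ι : Type) [Fintype ι] where
  mat : Matrix ι ι ℂ
  posSemidef : mat.PosSemidef
  trace_eq_one : mat.trace = 1

/-- A quantum measurement (POVM) with outcome set `O` on the Hilbert space with basis `ι`. -/
structure POVM (O ι : Type) [Fintype O] [Fintype ι] [DecidableEq ι] where
  effect : O → Matrix ι ι ℂ
  posSemidef : ∀ o, (effect o).PosSemidef
  sum_eq_one : ∑ o, effect o = 1

/-- Compatibility (joint measurability) of a family of measurements `M x`: there is one parent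
POVM `G` from which every `M x` is obtained by classical post-processing `p x l a = p(a | x, l)`. -/
def Compatible {X O ι : Type} [Fintype O] [Fintype ι] [DecidableEq ι]
    (M : X → POVM O ι) : Prop :=
  ∃ (k : ℕ) (G : POVM (Fin k) ι) (p : X → Fin k → O → ℝ),
    (∀ x l, p x l ∈ stdSimplex ℝ O) ∧
    ∀ x a, (M x).effect a = ∑ l, ((p x l a : ℝ) : ℂ) • G.effect l

/-- A quantum linear chain with `m + 1` independent sources and `m + 2` parties.
Source `i` emits a left particle of dimension `dL i` and a right particle of dimension `dR i`.
The first party holds the left particle of source `0`, the last party holds the right particle of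
source `m`, and the `k`-th of the `m` middle parties holds the right particle of source `k` and the
left particle of source `k + 1`. The first and the last party have inputs in `X` and `Y`;
every middle party performs one fixed measurement. -/
structure LinearNetwork (m : ℕ) (dL dR : Fin (m + 1) → ℕ) (X Y OA OC : Type)
    (OB : Fin m → Type) [Fintype OA] [Fintype OC] [∀ k, Fintype (OB k)] where
  state : ∀ i, DensityMatrix (Fin (dL i) × Fin (dR i))
  first : X → POVM OA (Fin (dL 0))
  middle : ∀ k : Fin m, POVM (OB k) (Fin (dR k.castSucc) × Fin (dL k.succ))
  last : Y → POVM OC (Fin (dR (Fin.last m)))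

/-- The conditional probabilities `P(a, b, c | x, y)`: `x`, `a` are input and output of the first
party, `b` lists the outputs of the middle parties, `y`, `c` are input and output of the last. -/
abbrev Behavior (m : ℕ) (X Y OA OC : Type) (OB : Fin m → Type) : Type :=
  X → Y → OA → (∀ k, OB k) → OC → ℝ

section Quantum

variable {m : ℕ} {dL dR : Fin (m + 1) → ℕ} {X Y OA OC : Type} {OB : Fin m → Type}
  [Fintype OA] [Fintype OC] [∀ k, Fintype (OB k)]

/-- The joint state `ρ₁ ⊗ ⋯ ⊗ ρₙ` of all the particles. -/
def LinearNetwork.globalState (N : LinearNetwork m dL dR X Y OA OC OB) :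
    Matrix (∀ i, Fin (dL i) × Fin (dR i)) (∀ i, Fin (dL i) × Fin (dR i)) ℂ :=
  Matrix.of fun s t => ∏ i, (N.state i).mat (s i) (t i)

/-- The tensor product of the parties' POVM elements, as an operator on all the particles. -/
def LinearNetwork.globalEffect (N : LinearNetwork m dL dR X Y OA OC OB)
    (x : X) (y : Y) (a : OA) (b : ∀ k, OB k) (c : OC) :
    Matrix (∀ i, Fin (dL i) × Fin (dR i)) (∀ i, Fin (dL i) × Fin (dR i)) ℂ :=
  Matrix.of fun s t =>
    (N.first x).effect a (s 0).1 (t 0).1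
      * (∏ k : Fin m, (N.middle k).effect (b k)
          ((s k.castSucc).2, (s k.succ).1) ((t k.castSucc).2, (t k.succ).1))
      * (N.last y).effect c (s (Fin.last m)).2 (t (Fin.last m)).2

/-- Born rule: the quantum correlations generated in the network. -/
def LinearNetwork.correlation (N : LinearNetwork m dL dR X Y OA OC OB) :
    Behavior m X Y OA OC OB :=
  fun x y a b c => (N.globalEffect x y a b c * N.globalState).trace.re

end Quantum

section Local

variable {m : ℕ} {X Y OA OC : Type} {OB : Fin m → Type}
  [Fintype OA] [Fintype OC] [∀ k, Fintype (OB k)]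

/-- `P` admits an `(m + 1)`-local hidden variable model: source `i` emits a hidden variable in an
arbitrary probability space `(Λ i, μ i)`, the hidden variables are independent, and the output
of each party is drawn from a distribution that depends only on its own input and on the hidden
variables of the sources adjacent to it. -/
def IsNLocal (P : Behavior m X Y OA OC OB) : Prop :=
  ∃ (Λ : Fin (m + 1) → Type) (_ : ∀ i, MeasurableSpace (Λ i))
    (μ : ∀ i, MeasureTheory.Measure (Λ i)) (_ : ∀ i, MeasureTheory.IsProbabilityMeasure (μ i))
    (p : X → Λ 0 → OA → ℝ)
    (q : ∀ k : Fin m, Λ k.castSucc → Λ k.succ → OB k → ℝ)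
    (r : Y → Λ (Fin.last m) → OC → ℝ),
    (∀ x l, p x l ∈ stdSimplex ℝ OA) ∧
    (∀ k l l', q k l l' ∈ stdSimplex ℝ (OB k)) ∧
    (∀ y l, r y l ∈ stdSimplex ℝ OC) ∧
    (∀ x a, Measurable fun l => p x l a) ∧
    (∀ k b, Measurable fun l : Λ k.castSucc × Λ k.succ => q k l.1 l.2 b) ∧
    (∀ y c, Measurable fun l => r y l c) ∧
    ∀ x y a b c, P x y a b c =
      ∫ l, p x (l 0) a * (∏ k : Fin m, q k (l k.castSucc) (l k.succ) (b k))
        * r y (l (Fin.last m)) c ∂(MeasureTheory.Measure.pi μ)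

/-- `P` admits an `(m + 1)`-local model whose hidden variables take finitely many values, so that
the model is a finite sum with product weights `∏ i, μ i (l i)`. -/
def IsFinitelyNLocal (P : Behavior m X Y OA OC OB) : Prop :=
  ∃ (K : Fin (m + 1) → ℕ) (μ : ∀ i, Fin (K i) → ℝ)
    (p : X → Fin (K 0) → OA → ℝ)
    (q : ∀ k : Fin m, Fin (K k.castSucc) → Fin (K k.succ) → OB k → ℝ)
    (r : Y → Fin (K (Fin.last m)) → OC → ℝ),
    (∀ i, μ i ∈ stdSimplex ℝ (Fin (K i))) ∧
    (∀ x l, p x l ∈ stdSimplex ℝ OA) ∧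
    (∀ k l l', q k l l' ∈ stdSimplex ℝ (OB k)) ∧
    (∀ y l, r y l ∈ stdSimplex ℝ OC) ∧
    ∀ x y a b c, P x y a b c =
      ∑ l : (∀ i, Fin (K i)), (∏ i, μ i (l i)) *
        (p x (l 0) a * (∏ k : Fin m, q k (l k.castSucc) (l k.succ) (b k))
          * r y (l (Fin.last m)) c)

/-- A model with finitely many hidden values is a model in the general sense. -/
theorem IsFinitelyNLocal.isNLocal {P : Behavior m X Y OA OC OB} (h : IsFinitelyNLocal P) :
    IsNLocal P := by
  obtain ⟨K, μ, p, q, r, hμ, hp, hq, hr, hP⟩ := h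
  let ν : ∀ i, MeasureTheory.Measure (Fin (K i)) := fun i =>
    ∑ j, ENNReal.ofReal (μ i j) • MeasureTheory.Measure.dirac j
  have hs : ∀ i j, ν i {j} = ENNReal.ofReal (μ i j) := by
    intro i j
    simp only [ν, MeasureTheory.Measure.coe_finsetSum, Finset.sum_apply,
      MeasureTheory.Measure.smul_apply, smul_eq_mul]
    rw [Finset.sum_eq_single j]
    · simp
    · intro b _ hb
      simp [hb]
    · simp
  have hν : ∀ i, MeasureTheory.IsProbabilityMeasure (ν i) := by
    intro i
    refine ⟨?_⟩
    simp only [ν, MeasureTheory.Measure.coe_finsetSum, Finset.sum_apply,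
      MeasureTheory.Measure.smul_apply, smul_eq_mul, MeasureTheory.measure_univ, mul_one]
    rw [← ENNReal.ofReal_sum_of_nonneg (fun j _ => (hμ i).1 j), (hμ i).2, ENNReal.ofReal_one]
  refine ⟨fun i => Fin (K i), fun i => inferInstance, ν, hν, p, q, r, hp, hq, hr,
    fun _ _ => measurable_of_finite _, fun _ _ => measurable_of_finite _,
    fun _ _ => measurable_of_finite _, ?_⟩
  intro x y a b c
  rw [hP, MeasureTheory.integral_fintype (MeasureTheory.Integrable.of_finite)]
  refine Finset.sum_congr rfl fun l _ => ?_
  rw [MeasureTheory.measureReal_def, MeasureTheory.Measure.pi_singleton, ENNReal.toReal_prod,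
    smul_eq_mul]
  congr 1
  refine Finset.prod_congr rfl fun i _ => ?_
  rw [hs, ENNReal.toReal_ofReal ((hμ i).1 _)]

end Local

end NLocal

end

noncomputable section

namespace NLocal

open Matrix

/-! For two sources, take as hidden variables the outcomes `l`, `l'` of the parent measurements at
the two ends. These measurements act on different, independent sources, so if the middle party's
output is ignored, `l` and `l'` are independent (`trace_chainOperator_one`). The middle party is
adjacent to both sources and may therefore output `b` with the quantum conditional probability given
`(l, l')`, while the ends post-process their own variable. Compatibility thus reduces each end to
one fixed measurement.

For at least three sources there are two adjacent middle parties, sharing a source that touches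
neither end, and no party sees all the hidden variables. The outcome `a` at the left end and the
outcomes `t` further right are determined by other sources, hence are independent of the shared one.
They act as free CHSH inputs, which the two middle parties must announce. Locality then gives a CHSH
inequality in which the marginals of `a` and `t` replace the usual bound 1 (`chsh_chain`, via
`integral_chain` and `chsh_le`; transferred to chains by `IsNLocal.chsh`).

Bell pairs violate it. Measuring the outer pairs in the computational basis gives neighbours
correlated bits to use as inputs, and the middle pair is used for a CHSH test of value 14/5. This
leaves room for the noise that makes the end measurements compatible. The violation needs only input
0 at each end. -/

/-- The trace of a product of two positive semidefinite matrices is nonnegative. -/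
theorem trace_mul_nonneg_of_posSemidef {ι : Type*} [Fintype ι] {A B : Matrix ι ι ℂ}
    (hA : A.PosSemidef) (hB : B.PosSemidef) : 0 ≤ (A * B).trace := by
  -- `tr (A * B)` is the quadratic form of the Hadamard product of `A` and `Bᵀ` at the all-ones
  -- vector, so the Schur product theorem applies.
  have h := (hA.hadamard hB.transpose).dotProduct_mulVec_nonneg (fun _ => (1 : ℂ))
  convert h using 1
  simp [Matrix.trace, Matrix.mul_apply, dotProduct, mulVec]

theorem DensityMatrix.nonempty {ι : Type} [Fintype ι] (ρ : DensityMatrix ι) : Nonempty ι := by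
  by_contra h
  rw [not_nonempty_iff] at h
  have := ρ.trace_eq_one
  simp [Matrix.trace] at this

theorem POVM.nonempty {O ι : Type} [Fintype O] [Fintype ι] [DecidableEq ι] [Nonempty ι]
    (M : POVM O ι) : Nonempty O := by
  by_contra h
  rw [not_nonempty_iff] at h
  have := M.sum_eq_one
  simp at this

/-! ### Two sources: operators on the chain and the bilocal model. -/

section Product

variable {m : ℕ} {dL dR : Fin (m + 1) → ℕ}

/-- The tensor product of operators acting on the particles of the single parties of a chain. -/
def chainOperator (A : Matrix (Fin (dL 0)) (Fin (dL 0)) ℂ)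
    (B : ∀ k : Fin m, Matrix (Fin (dR k.castSucc) × Fin (dL k.succ))
      (Fin (dR k.castSucc) × Fin (dL k.succ)) ℂ)
    (C : Matrix (Fin (dR (Fin.last m))) (Fin (dR (Fin.last m))) ℂ) :
    Matrix (∀ i, Fin (dL i) × Fin (dR i)) (∀ i, Fin (dL i) × Fin (dR i)) ℂ :=
  Matrix.of fun s t =>
    A (s 0).1 (t 0).1
      * (∏ k : Fin m, B k ((s k.castSucc).2, (s k.succ).1) ((t k.castSucc).2, (t k.succ).1))
      * C (s (Fin.last m)).2 (t (Fin.last m)).2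

end Product

section Two

variable {dL dR : Fin 2 → ℕ}

/-- A tensor product is the Hadamard product of its factors pulled back along coordinate
projections; pullbacks and Hadamard products preserve positivity. -/
theorem chainOperator_posSemidef {A : Matrix (Fin (dL 0)) (Fin (dL 0)) ℂ}
    {B : ∀ k : Fin 1, Matrix (Fin (dR k.castSucc) × Fin (dL k.succ))
      (Fin (dR k.castSucc) × Fin (dL k.succ)) ℂ}
    {C : Matrix (Fin (dR (Fin.last 1))) (Fin (dR (Fin.last 1))) ℂ}
    (hA : A.PosSemidef) (hB : ∀ k, (B k).PosSemidef) (hC : C.PosSemidef) :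
    (chainOperator A B C).PosSemidef := by
  have h := ((hA.submatrix fun s : ∀ i, Fin (dL i) × Fin (dR i) => (s 0).1).hadamard
    ((hB 0).submatrix fun s : ∀ i, Fin (dL i) × Fin (dR i) =>
      ((s (0 : Fin 1).castSucc).2, (s (0 : Fin 1).succ).1))).hadamard
    (hC.submatrix fun s : ∀ i, Fin (dL i) × Fin (dR i) => (s (Fin.last 1)).2)
  refine (congrArg Matrix.PosSemidef ?_).mpr h
  ext s t
  simp only [chainOperator, Matrix.of_apply, Fin.prod_univ_one]
  rfl

/-- The joint state of two sources. -/
def pairState (ρ : ∀ i, DensityMatrix (Fin (dL i) × Fin (dR i))) :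
    Matrix (∀ i, Fin (dL i) × Fin (dR i)) (∀ i, Fin (dL i) × Fin (dR i)) ℂ :=
  Matrix.of fun s t => ∏ i, (ρ i).mat (s i) (t i)

theorem pairState_posSemidef (ρ : ∀ i, DensityMatrix (Fin (dL i) × Fin (dR i))) :
    (pairState ρ).PosSemidef := by
  have h := ((ρ 0).posSemidef.submatrix fun s : ∀ i, Fin (dL i) × Fin (dR i) => s 0).hadamard
    ((ρ 1).posSemidef.submatrix fun s : ∀ i, Fin (dL i) × Fin (dR i) => s 1)
  refine (congrArg Matrix.PosSemidef ?_).mpr h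
  ext s t
  simp only [pairState, Matrix.of_apply, Fin.prod_univ_two]
  rfl

open scoped Kronecker in
/-- If the middle party does nothing, the two sources factorize. -/
theorem trace_chainOperator_one (A : Matrix (Fin (dL 0)) (Fin (dL 0)) ℂ)
    (C : Matrix (Fin (dR 1)) (Fin (dR 1)) ℂ)
    (ρ : ∀ i, DensityMatrix (Fin (dL i) × Fin (dR i))) :
    (chainOperator A (fun _ => 1) C * pairState ρ).trace =
      ((A ⊗ₖ (1 : Matrix (Fin (dR 0)) (Fin (dR 0)) ℂ)) * (ρ 0).mat).trace *
        (((1 : Matrix (Fin (dL 1)) (Fin (dL 1)) ℂ) ⊗ₖ C) * (ρ 1).mat).trace := by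
  simp only [Matrix.trace, Matrix.diag_apply, Matrix.mul_apply]
  rw [← (piFinTwoEquiv fun i : Fin 2 => Fin (dL i) × Fin (dR i)).symm.sum_comp]
  simp_rw [← (piFinTwoEquiv fun i : Fin 2 => Fin (dL i) × Fin (dR i)).symm.sum_comp
    (fun t => chainOperator A (fun _ => 1) C _ t * _)]
  rw [Finset.sum_mul_sum, Fintype.sum_prod_type]
  refine Finset.sum_congr rfl fun s₀ _ => Finset.sum_congr rfl fun s₁ _ => ?_
  rw [Finset.sum_mul_sum, Fintype.sum_prod_type]
  refine Finset.sum_congr rfl fun t₀ _ => Finset.sum_congr rfl fun t₁ _ => ?_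
  -- The middle party is the only link between the two sources, and its identity operator splits
  -- into one identity per particle.
  have h1 : (1 : Matrix (Fin (dR 0) × Fin (dL 1)) (Fin (dR 0) × Fin (dL 1)) ℂ)
      (s₀.2, s₁.1) (t₀.2, t₁.1) = (1 : Matrix (Fin (dR 0)) (Fin (dR 0)) ℂ) s₀.2 t₀.2 *
        (1 : Matrix (Fin (dL 1)) (Fin (dL 1)) ℂ) s₁.1 t₁.1 := by
    simp only [Matrix.one_apply, Prod.mk.injEq]
    split_ifs <;> simp_all
  have h2 : chainOperator A (fun _ => 1) C
      ((piFinTwoEquiv fun i : Fin 2 => Fin (dL i) × Fin (dR i)).symm (s₀, s₁))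
      ((piFinTwoEquiv fun i : Fin 2 => Fin (dL i) × Fin (dR i)).symm (t₀, t₁)) =
      A s₀.1 t₀.1 * (1 : Matrix (Fin (dR 0) × Fin (dL 1)) (Fin (dR 0) × Fin (dL 1)) ℂ)
      (s₀.2, s₁.1) (t₀.2, t₁.1) * C s₁.2 t₁.2 := by
    simp only [chainOperator, Matrix.of_apply, Fin.prod_univ_one]
    rfl
  have h3 : pairState ρ ((piFinTwoEquiv fun i : Fin 2 => Fin (dL i) × Fin (dR i)).symm (t₀, t₁))
      ((piFinTwoEquiv fun i : Fin 2 => Fin (dL i) × Fin (dR i)).symm (s₀, s₁)) =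
      (ρ 0).mat t₀ s₀ * (ρ 1).mat t₁ s₁ := by
    simp only [pairState, Matrix.of_apply, Fin.prod_univ_two]
    rfl
  rw [h2, h3, h1]
  simp only [Matrix.kroneckerMap_apply]
  ring

theorem chainOperator_sum_middle {O : Fin 1 → Type} [∀ k, Fintype (O k)]
    (A : Matrix (Fin (dL 0)) (Fin (dL 0)) ℂ)
    (M : ∀ k : Fin 1, POVM (O k) (Fin (dR k.castSucc) × Fin (dL k.succ)))
    (C : Matrix (Fin (dR 1)) (Fin (dR 1)) ℂ) :
    ∑ b : ∀ k, O k, chainOperator A (fun k => (M k).effect (b k)) C =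
      chainOperator A (fun _ => 1) C := by
  ext s t
  simp only [Matrix.sum_apply, chainOperator, Matrix.of_apply]
  rw [← Finset.sum_mul, ← Finset.mul_sum]
  have h := Finset.prod_univ_sum (fun k => (Finset.univ : Finset (O k)))
    fun k b => (M k).effect b ((s k.castSucc).2, (s k.succ).1) ((t k.castSucc).2, (t k.succ).1)
  rw [Fintype.piFinset_univ] at h
  rw [← h]
  congr 2
  refine Finset.prod_congr rfl fun k _ => ?_
  rw [← (M k).sum_eq_one, Matrix.sum_apply]

theorem chainOperator_sum_smul {m : ℕ} {dL dR : Fin (m + 1) → ℕ} {k k' : ℕ}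
    (g : Fin k → ℂ) (G : Fin k → Matrix (Fin (dL 0)) (Fin (dL 0)) ℂ)
    (B : ∀ k : Fin m, Matrix (Fin (dR k.castSucc) × Fin (dL k.succ))
      (Fin (dR k.castSucc) × Fin (dL k.succ)) ℂ)
    (h : Fin k' → ℂ) (H : Fin k' → Matrix (Fin (dR (Fin.last m))) (Fin (dR (Fin.last m))) ℂ) :
    chainOperator (∑ l, g l • G l) B (∑ l', h l' • H l') =
      ∑ l, ∑ l', (g l * h l') • chainOperator (G l) B (H l') := by
  ext s t
  simp only [Matrix.sum_apply, chainOperator, Matrix.of_apply, Matrix.smul_apply, smul_eq_mul]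
  simp only [Finset.sum_mul, Finset.mul_sum]
  rw [Finset.sum_comm]
  refine Finset.sum_congr rfl fun l _ => Finset.sum_congr rfl fun l' _ => ?_
  ring

/-- A bilocal model, given without the indexing by sources. -/
theorem isFinitelyNLocal_of_pair {X Y OA OC : Type} {OB : Fin 1 → Type}
    [Fintype OA] [Fintype OC] [∀ k, Fintype (OB k)] {P : Behavior 1 X Y OA OC OB} {k₀ k₁ : ℕ}
    {μ₀ : Fin k₀ → ℝ} {μ₁ : Fin k₁ → ℝ} {p : X → Fin k₀ → OA → ℝ}
    {q : Fin k₀ → Fin k₁ → OB 0 → ℝ} {r : Y → Fin k₁ → OC → ℝ}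
    (hμ₀ : μ₀ ∈ stdSimplex ℝ (Fin k₀)) (hμ₁ : μ₁ ∈ stdSimplex ℝ (Fin k₁))
    (hp : ∀ x l, p x l ∈ stdSimplex ℝ OA) (hq : ∀ l l', q l l' ∈ stdSimplex ℝ (OB 0))
    (hr : ∀ y l, r y l ∈ stdSimplex ℝ OC)
    (hP : ∀ x y a b c, P x y a b c =
      ∑ l, ∑ l', μ₀ l * μ₁ l' * (p x l a * q l l' (b 0) * r y l' c)) :
    IsFinitelyNLocal P := by
  let K : Fin 2 → ℕ := ![k₀, k₁]
  refine ⟨K, Fin.cons (α := fun i => Fin (K i) → ℝ) μ₀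
      (Fin.cons (α := fun i : Fin 1 => Fin (K i.succ) → ℝ) μ₁ finZeroElim), p,
    Fin.cons (α := fun k : Fin 1 => Fin (K k.castSucc) → Fin (K k.succ) → OB k → ℝ) q
      finZeroElim, r, ?_, hp, ?_, hr, ?_⟩
  · exact Fin.forall_fin_two.2 ⟨hμ₀, hμ₁⟩
  · exact Fin.forall_fin_one.2 hq
  · intro x y a b c
    rw [hP, ← (piFinTwoEquiv fun i : Fin 2 => Fin (K i)).symm.sum_comp, Fintype.sum_prod_type]
    refine Finset.sum_congr rfl fun l _ => Finset.sum_congr rfl fun l' _ => ?_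
    rw [Fin.prod_univ_two, Fin.prod_univ_one]
    rfl

open scoped Kronecker in
/-- With compatible measurements at both ends, a chain of two sources is bilocal. -/
theorem LinearNetwork.isFinitelyNLocal_of_compatible {X Y OA OC : Type} {OB : Fin 1 → Type}
    [Fintype OA] [Fintype OC] [∀ k, Fintype (OB k)]
    (N : LinearNetwork 1 dL dR X Y OA OC OB) (hA : Compatible N.first) (hC : Compatible N.last) :
    IsFinitelyNLocal N.correlation := by
  classical
  obtain ⟨k₀, G, p, hp, hG⟩ := hA
  obtain ⟨k₁, H', r, hr, hH⟩ := hC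
  let H : POVM (Fin k₁) (Fin (dR 1)) := H'
  -- `Q l l' b` is the joint quantum probability of the parent outcomes `l`, `l'` and the middle
  -- outputs `b`.
  let Q : Fin k₀ → Fin k₁ → (∀ k, OB k) → ℂ := fun l l' b =>
    (chainOperator (G.effect l) (fun k => (N.middle k).effect (b k)) (H.effect l')
      * pairState N.state).trace
  have hQ : ∀ l l' b, 0 ≤ Q l l' b := fun l l' b =>
    trace_mul_nonneg_of_posSemidef (chainOperator_posSemidef (G.posSemidef l)
      (fun k => (N.middle k).posSemidef (b k)) (H.posSemidef l')) (pairState_posSemidef N.state)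
  let w₀ : Fin k₀ → ℂ := fun l =>
    ((G.effect l ⊗ₖ (1 : Matrix (Fin (dR 0)) (Fin (dR 0)) ℂ)) * (N.state 0).mat).trace
  let w₁ : Fin k₁ → ℂ := fun l' =>
    (((1 : Matrix (Fin (dL 1)) (Fin (dL 1)) ℂ) ⊗ₖ H.effect l') * (N.state 1).mat).trace
  have hw₀ : ∀ l, 0 ≤ w₀ l := fun l =>
    trace_mul_nonneg_of_posSemidef ((G.posSemidef l).kronecker .one) (N.state 0).posSemidef
  have hw₁ : ∀ l, 0 ≤ w₁ l := fun l =>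
    trace_mul_nonneg_of_posSemidef (Matrix.PosSemidef.one.kronecker (H.posSemidef l))
      (N.state 1).posSemidef
  have hw₀s : ∑ l, w₀ l = 1 := by
    simp only [w₀]
    rw [← Matrix.trace_sum, ← Finset.sum_mul]
    have : ∑ l, G.effect l ⊗ₖ (1 : Matrix (Fin (dR 0)) (Fin (dR 0)) ℂ) = 1 := by
      rw [← Matrix.one_kronecker_one, ← G.sum_eq_one]
      ext i j
      simp [Matrix.sum_apply, Finset.sum_mul]
    rw [this, one_mul, (N.state 0).trace_eq_one]
  have hw₁s : ∑ l, w₁ l = 1 := by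
    simp only [w₁]
    rw [← Matrix.trace_sum, ← Finset.sum_mul]
    have : ∑ l, (1 : Matrix (Fin (dL 1)) (Fin (dL 1)) ℂ) ⊗ₖ H.effect l = 1 := by
      rw [← Matrix.one_kronecker_one (m := Fin (dL 1)) (n := Fin (dR 1))]
      have h := H.sum_eq_one
      ext i j
      rw [Matrix.kroneckerMap_apply, ← h]
      simp [Matrix.sum_apply, Finset.mul_sum]
    rw [this, one_mul, (N.state 1).trace_eq_one]
  have hQs : ∀ l l', ∑ b, Q l l' b = w₀ l * w₁ l' := by
    intro l l'
    simp only [Q]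
    rw [← Matrix.trace_sum, ← Finset.sum_mul, chainOperator_sum_middle, trace_chainOperator_one]
  have hre : ∀ {z : ℂ}, 0 ≤ z → 0 ≤ z.re ∧ z.im = 0 := fun h =>
    ⟨(Complex.nonneg_iff.1 h).1, (Complex.nonneg_iff.1 h).2.symm⟩
  have hmul : ∀ l l', (w₀ l * w₁ l').re = (w₀ l).re * (w₁ l').re := fun l l' => by
    rw [Complex.mul_re, (hre (hw₀ l)).2, zero_mul, sub_zero]
  have hQr : ∀ l l', ∑ b, (Q l l' b).re = (w₀ l).re * (w₁ l').re := fun l l' => by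
    rw [← hmul l l', ← hQs, Complex.re_sum]
  -- An outcome `b₀` is needed as the default response for pairs `(l, l')` of probability zero.
  have : Nonempty (OB 0) := by
    have : Nonempty (Fin (dR (0 : Fin 1).castSucc) × Fin (dL (0 : Fin 1).succ)) := by
      obtain ⟨i⟩ := (N.state 0).nonempty
      obtain ⟨j⟩ := (N.state 1).nonempty
      exact ⟨(i.2, j.1)⟩
    exact (N.middle 0).nonempty
  obtain ⟨b₀⟩ := this
  let e : OB 0 → ∀ k, OB k := fun b => Fin.cons (α := OB) b finZeroElim
  have he : ∀ b : ∀ k, OB k, e (b 0) = b := fun b => by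
    funext k
    obtain rfl : k = 0 := Subsingleton.elim _ _
    rfl
  have hQe : ∀ l l', ∑ b, (Q l l' (e b)).re = (w₀ l).re * (w₁ l').re := fun l l' => by
    rw [← hQr]
    exact Fintype.sum_equiv ⟨e, fun b => b 0, fun _ => rfl, he⟩ _ _ fun _ => rfl
  let q : Fin k₀ → Fin k₁ → OB 0 → ℝ := fun l l' =>
    if (w₀ l).re * (w₁ l').re = 0 then Pi.single b₀ 1
    else fun b => (Q l l' (e b)).re / ((w₀ l).re * (w₁ l').re)
  have hq : ∀ l l', q l l' ∈ stdSimplex ℝ (OB 0) := by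
    intro l l'
    by_cases h : (w₀ l).re * (w₁ l').re = 0
    · simp only [q, if_pos h]
      exact single_mem_stdSimplex ℝ b₀
    · simp only [q, if_neg h]
      refine ⟨fun b => div_nonneg (hre (hQ l l' _)).1
        (mul_nonneg (hre (hw₀ l)).1 (hre (hw₁ l')).1), ?_⟩
      rw [← Finset.sum_div, hQe, div_self h]
  -- The default response is harmless: if the weight of `(l, l')` vanishes, so does each of the
  -- nonnegative terms `Q l l' b` that sum to it.
  have hwq : ∀ l l' b, (w₀ l).re * (w₁ l').re * q l l' b = (Q l l' (e b)).re := by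
    intro l l' b
    by_cases h : (w₀ l).re * (w₁ l').re = 0
    · rw [h, zero_mul]
      have h0 := hQe l l'
      rw [h, Finset.sum_eq_zero_iff_of_nonneg fun b _ => (hre (hQ l l' _)).1] at h0
      exact (h0 b (Finset.mem_univ _)).symm
    · simp only [q, if_neg h]
      exact mul_div_cancel₀ _ h
  refine isFinitelyNLocal_of_pair (μ₀ := fun l => (w₀ l).re) (μ₁ := fun l => (w₁ l).re)
    ⟨fun l => (hre (hw₀ l)).1, by rw [← Complex.re_sum, hw₀s, Complex.one_re]⟩
    ⟨fun l => (hre (hw₁ l)).1, by rw [← Complex.re_sum, hw₁s, Complex.one_re]⟩ hp hq hr ?_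
  intro x y a b c
  have h1 : N.globalEffect x y a b c = ∑ l, ∑ l', (((p x l a : ℝ) : ℂ) * ((r y l' c : ℝ) : ℂ)) •
      chainOperator (G.effect l) (fun k => (N.middle k).effect (b k)) (H.effect l') := by
    rw [← chainOperator_sum_smul, ← hG, ← hH]
    rfl
  have h2 : N.globalState = pairState N.state := rfl
  rw [LinearNetwork.correlation, h1, h2]
  simp only [Finset.sum_mul, Matrix.trace_sum, Matrix.smul_mul, Matrix.trace_smul, smul_eq_mul,
    Complex.re_sum]
  refine Finset.sum_congr rfl fun l _ => Finset.sum_congr rfl fun l' _ => ?_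
  have h3 := hwq l l' (b 0)
  rw [he] at h3
  rw [← Complex.ofReal_mul, Complex.re_ofReal_mul]
  change p x l a * r y l' c * (Q l l' b).re = _
  rw [← h3]
  ring

end Two

open MeasureTheory

/-! ### A CHSH inequality for three independent hidden variables. -/

section LocalBound

/-- The sign `(-1) ^ b`. -/
def sgn (b : Fin 2) : ℝ := if b = 0 then 1 else -1

@[simp] theorem sgn_zero : sgn 0 = 1 := rfl

@[simp] theorem sgn_one : sgn 1 = -1 := rfl

/-- Group as `α 0 * (γ 0 + γ 1) + α 1 * (γ 0 - γ 1)` and use that `|γ 0 + γ 1| + |γ 0 - γ 1|` is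
twice the larger of `|γ 0|`, `|γ 1|`. -/
theorem chsh_le {α γ : Fin 2 → ℝ} {π ρ : ℝ} (hα : ∀ a, |α a| ≤ π) (hγ : ∀ t, |γ t| ≤ ρ) :
    α 0 * γ 0 + α 0 * γ 1 + α 1 * γ 0 - α 1 * γ 1 ≤ 2 * (π * ρ) := by
  have h0 := hα 0
  have h1 := hα 1
  have hπ : 0 ≤ π := (abs_nonneg _).trans h0
  have k0 := abs_le.1 (hγ 0)
  have k1 := abs_le.1 (hγ 1)
  have e1 : α 0 * (γ 0 + γ 1) ≤ π * |γ 0 + γ 1| :=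
    (le_abs_self _).trans (by rw [abs_mul]; exact mul_le_mul_of_nonneg_right h0 (abs_nonneg _))
  have e2 : α 1 * (γ 0 - γ 1) ≤ π * |γ 0 - γ 1| :=
    (le_abs_self _).trans (by rw [abs_mul]; exact mul_le_mul_of_nonneg_right h1 (abs_nonneg _))
  have e3 : |γ 0 + γ 1| + |γ 0 - γ 1| ≤ 2 * ρ := by
    rcases abs_cases (γ 0 + γ 1) with h | h <;> rcases abs_cases (γ 0 - γ 1) with h' | h' <;>
      linarith
  nlinarith [mul_le_mul_of_nonneg_left e3 hπ]

variable {Ω₀ Ω₁ Ω₂ : Type} [MeasurableSpace Ω₀] [MeasurableSpace Ω₁] [MeasurableSpace Ω₂]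
  {μ₀ : Measure Ω₀} {μ₁ : Measure Ω₁} {μ₂ : Measure Ω₂}
  [IsProbabilityMeasure μ₀] [IsProbabilityMeasure μ₁] [IsProbabilityMeasure μ₂]

theorem integrable_of_abs_le_one {Ω : Type} [MeasurableSpace Ω] {μ : Measure Ω}
    [IsProbabilityMeasure μ] {f : Ω → ℝ} (hf : Measurable f) (h : ∀ ω, |f ω| ≤ 1) :
    Integrable f μ :=
  Integrable.of_bound hf.aestronglyMeasurable 1 (Filter.Eventually.of_forall h)

theorem abs_mul_le_one {x y : ℝ} (hx : |x| ≤ 1) (hy : |y| ≤ 1) : |x * y| ≤ 1 := by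
  rw [abs_mul]
  exact mul_le_one₀ hx (abs_nonneg _) hy

/-- The two ends of a chain of three independent variables are independent given the middle. -/
theorem integral_chain {F : Ω₀ × Ω₁ → ℝ} {H : Ω₁ × Ω₂ → ℝ}
    (hF : Measurable F) (hH : Measurable H) (hF1 : ∀ z, |F z| ≤ 1) (hH1 : ∀ z, |H z| ≤ 1) :
    ∫ l, F (l.1, l.2.1) * H (l.2.1, l.2.2) ∂(μ₀.prod (μ₁.prod μ₂)) =
      ∫ l₁, (∫ l₀, F (l₀, l₁) ∂μ₀) * (∫ l₂, H (l₁, l₂) ∂μ₂) ∂μ₁ := by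
  have hγ : Measurable fun l₁ => ∫ l₂, H (l₁, l₂) ∂μ₂ :=
    (hH.stronglyMeasurable.integral_prod_right').measurable
  have hγ1 : ∀ l₁, |∫ l₂, H (l₁, l₂) ∂μ₂| ≤ 1 := fun l₁ => by
    simpa using norm_integral_le_of_norm_le_const (μ := μ₂) (f := fun l₂ => H (l₁, l₂))
      (Filter.Eventually.of_forall fun l₂ => hH1 (l₁, l₂))
  rw [integral_prod]
  · have h : ∀ l₀, ∫ z, F (l₀, z.1) * H (z.1, z.2) ∂(μ₁.prod μ₂) =
        ∫ l₁, F (l₀, l₁) * (∫ l₂, H (l₁, l₂) ∂μ₂) ∂μ₁ := by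
      intro l₀
      rw [integral_prod]
      · simp_rw [integral_const_mul]
      · exact integrable_of_abs_le_one (by fun_prop) fun z => abs_mul_le_one (hF1 _) (hH1 _)
    simp_rw [h]
    rw [integral_integral_swap]
    · simp_rw [integral_mul_const]
    · exact integrable_of_abs_le_one (hF.mul (hγ.comp measurable_snd))
        fun z => abs_mul_le_one (hF1 _) (hγ1 _)
  · exact integrable_of_abs_le_one (by fun_prop) fun z => abs_mul_le_one (hF1 _) (hH1 _)

theorem abs_le_one_of_mem_stdSimplex {O : Type} [Fintype O] {f : O → ℝ} (hf : f ∈ stdSimplex ℝ O)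
    (o : O) : |f o| ≤ 1 := by
  rw [abs_of_nonneg (hf.1 o)]
  exact hf.2 ▸ Finset.single_le_sum (fun i _ => hf.1 i) (Finset.mem_univ o)

theorem abs_sub_le_one_of_mem_stdSimplex {O : Type} [Fintype O] {f : O → ℝ}
    (hf : f ∈ stdSimplex ℝ O) (o o' : O) : |f o - f o'| ≤ 1 := by
  have h := abs_le_one_of_mem_stdSimplex hf o
  have h' := abs_le_one_of_mem_stdSimplex hf o'
  rw [abs_of_nonneg (hf.1 _)] at h h'
  exact abs_le.2 ⟨by linarith [hf.1 o], by linarith [hf.1 o']⟩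

theorem abs_integral_le_of_abs_mul_le {Ω : Type} [MeasurableSpace Ω] {μ : Measure Ω}
    [IsProbabilityMeasure μ] {f g : Ω → ℝ} (hf : Measurable f) (hf0 : ∀ ω, 0 ≤ f ω)
    (hf1 : ∀ ω, |f ω| ≤ 1) (hg : ∀ ω, |g ω| ≤ 1) : |∫ ω, f ω * g ω ∂μ| ≤ ∫ ω, f ω ∂μ :=
  norm_integral_le_of_norm_le (f := fun ω => f ω * g ω) (integrable_of_abs_le_one hf hf1)
    (Filter.Eventually.of_forall fun ω => by
      have h := mul_le_of_le_one_right (abs_nonneg (f ω)) (hg ω)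
      rwa [← abs_mul, abs_of_nonneg (hf0 ω)] at h)

/-- The CHSH inequality for a chain of three independent variables: `a` and `t` act as the inputs
of the two parties in the middle, who have to announce them. -/
theorem chsh_chain {p : Fin 2 → Ω₀ → ℝ} {q₀ : Ω₀ → Ω₁ → Fin 2 × Fin 2 → ℝ}
    {q₁ : Ω₁ → Ω₂ → Fin 2 × Fin 2 → ℝ} {R : Fin 2 → Ω₂ → ℝ}
    (hp : ∀ a, Measurable (p a)) (hp0 : ∀ a l, 0 ≤ p a l) (hp1 : ∀ a l, |p a l| ≤ 1)
    (hq₀ : ∀ b, Measurable fun l : Ω₀ × Ω₁ => q₀ l.1 l.2 b)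
    (hq₀s : ∀ l l', q₀ l l' ∈ stdSimplex ℝ (Fin 2 × Fin 2))
    (hq₁ : ∀ b, Measurable fun l : Ω₁ × Ω₂ => q₁ l.1 l.2 b)
    (hq₁s : ∀ l l', q₁ l l' ∈ stdSimplex ℝ (Fin 2 × Fin 2))
    (hR : ∀ t, Measurable (R t)) (hR0 : ∀ t l, 0 ≤ R t l) (hR1 : ∀ t l, |R t l| ≤ 1)
    {P : Fin 2 → Fin 2 × Fin 2 → Fin 2 × Fin 2 → Fin 2 → ℝ}
    (hP : ∀ a b b' t, P a b b' t = ∫ l, p a l.1 * q₀ l.1 l.2.1 b * (q₁ l.2.1 l.2.2 b' * R t l.2.2)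
      ∂(μ₀.prod (μ₁.prod μ₂)))
    {C : ℝ} (hC : 0 < C) (hPC : ∀ a t, ∑ b, ∑ b', P a b b' t = C) :
    ∑ a, ∑ t, ∑ b, ∑ c, (if a = 1 ∧ t = 1 then -1 else 1) * sgn b * sgn c * P a (a, b) (c, t) t
      ≤ 2 * C := by
  have hint : ∀ a b b' t, Integrable (fun l : Ω₀ × Ω₁ × Ω₂ =>
      p a l.1 * q₀ l.1 l.2.1 b * (q₁ l.2.1 l.2.2 b' * R t l.2.2)) (μ₀.prod (μ₁.prod μ₂)) := by
    intro a b b' t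
    refine integrable_of_abs_le_one ?_ fun l => abs_mul_le_one
      (abs_mul_le_one (hp1 _ _) (abs_le_one_of_mem_stdSimplex (hq₀s _ _) _))
      (abs_mul_le_one (abs_le_one_of_mem_stdSimplex (hq₁s _ _) _) (hR1 _ _))
    exact (((hp a).comp measurable_fst).mul ((hq₀ b).comp (by fun_prop :
      Measurable fun l : Ω₀ × Ω₁ × Ω₂ => (l.1, l.2.1)))).mul
      (((hq₁ b').comp measurable_snd).mul ((hR t).comp (by fun_prop)))
  -- Summing out the announced outputs leaves the product of the two end marginals. As this is the
  -- same `C > 0` for all `a` and `t`, neither marginal depends on its index.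
  have hprod : ∀ a t, (∫ l, p a l ∂μ₀) * (∫ l, R t l ∂μ₂) = C := by
    intro a t
    rw [← hPC a t]
    simp_rw [hP]
    have h := integral_chain (μ₀ := μ₀) (μ₁ := μ₁) (μ₂ := μ₂) (F := fun z => p a z.1)
      (H := fun z => R t z.2) ((hp a).comp measurable_fst) ((hR t).comp measurable_snd)
      (fun z => hp1 a _) (fun z => hR1 t _)
    simp only [integral_const, probReal_univ, one_smul] at h
    rw [← h]
    simp_rw [← integral_finsetSum _ fun b' _ => hint a _ b' t]
    rw [← integral_finsetSum _ fun b _ => integrable_finsetSum _ fun b' _ => hint a b b' t]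
    refine integral_congr_ae (Filter.Eventually.of_forall fun l => ?_)
    simp only
    simp_rw [← Finset.mul_sum, ← Finset.sum_mul, ← Finset.mul_sum]
    rw [(hq₀s _ _).2, (hq₁s _ _).2]
    ring
  have hπ : ∀ a, ∫ l, p a l ∂μ₀ = ∫ l, p 0 l ∂μ₀ := by
    intro a
    have h := (hprod a 0).trans (hprod 0 0).symm
    exact mul_right_cancel₀ (fun h0 => hC.ne' (by rw [← hprod 0 0, h0, mul_zero])) h
  have hρ : ∀ t, ∫ l, R t l ∂μ₂ = ∫ l, R 0 l ∂μ₂ := by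
    intro t
    have h := (hprod 0 t).trans (hprod 0 0).symm
    exact mul_left_cancel₀ (fun h0 => hC.ne' (by rw [← hprod 0 0, h0, zero_mul])) h
  -- Only outputs that announce the correct input `a` enter; a wrong announcement contributes zero
  -- to the correlator.
  let F : Fin 2 → Ω₀ × Ω₁ → ℝ := fun a z => p a z.1 * (q₀ z.1 z.2 (a, 0) - q₀ z.1 z.2 (a, 1))
  let H : Fin 2 → Ω₁ × Ω₂ → ℝ := fun t z => R t z.2 * (q₁ z.1 z.2 (0, t) - q₁ z.1 z.2 (1, t))
  have hFm : ∀ a, Measurable (F a) := fun a =>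
    ((hp a).comp measurable_fst).mul ((hq₀ _).sub (hq₀ _))
  have hHm : ∀ t, Measurable (H t) := fun t =>
    ((hR t).comp measurable_snd).mul ((hq₁ _).sub (hq₁ _))
  have hF1 : ∀ a z, |F a z| ≤ 1 := fun a z =>
    abs_mul_le_one (hp1 _ _) (abs_sub_le_one_of_mem_stdSimplex (hq₀s _ _) _ _)
  have hH1 : ∀ t z, |H t z| ≤ 1 := fun t z =>
    abs_mul_le_one (hR1 _ _) (abs_sub_le_one_of_mem_stdSimplex (hq₁s _ _) _ _)
  -- Given the shared variable, the two sides are independent, so the correlator becomes `α a * γ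
  -- t`, each factor bounded by its end marginal.
  let α : Fin 2 → Ω₁ → ℝ := fun a l₁ => ∫ l₀, F a (l₀, l₁) ∂μ₀
  let γ : Fin 2 → Ω₁ → ℝ := fun t l₁ => ∫ l₂, H t (l₁, l₂) ∂μ₂
  have hα : ∀ a l, |α a l| ≤ ∫ l, p 0 l ∂μ₀ := fun a l => by
    rw [← hπ a]
    exact abs_integral_le_of_abs_mul_le (hp a) (hp0 a) (hp1 a)
      fun l₀ => abs_sub_le_one_of_mem_stdSimplex (hq₀s _ _) _ _
  have hγ : ∀ t l, |γ t l| ≤ ∫ l, R 0 l ∂μ₂ := fun t l => by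
    rw [← hρ t]
    exact abs_integral_le_of_abs_mul_le (hR t) (hR0 t) (hR1 t)
      fun l₂ => abs_sub_le_one_of_mem_stdSimplex (hq₁s _ _) _ _
  have hαm : ∀ a, Measurable (α a) := fun a =>
    ((hFm a).stronglyMeasurable.integral_prod_left').measurable
  have hγm : ∀ t, Measurable (γ t) := fun t =>
    ((hHm t).stronglyMeasurable.integral_prod_right').measurable
  have hαγ : ∀ a t, Integrable (fun l => α a l * γ t l) μ₁ := fun a t =>
    Integrable.of_bound ((hαm a).mul (hγm t)).aestronglyMeasurable
      ((∫ l, p 0 l ∂μ₀) * ∫ l, R 0 l ∂μ₂) (Filter.Eventually.of_forall fun l => by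
        rw [Real.norm_eq_abs, abs_mul]
        exact mul_le_mul (hα a l) (hγ t l) (abs_nonneg _) ((abs_nonneg _).trans (hα a l)))
  have hE : ∀ a t, P a (a, 0) (0, t) t + P a (a, 1) (1, t) t
      - (P a (a, 0) (1, t) t + P a (a, 1) (0, t) t) = ∫ l, α a l * γ t l ∂μ₁ := by
    intro a t
    rw [← integral_chain (hFm a) (hHm t) (hF1 a) (hH1 t)]
    simp_rw [hP]
    rw [← integral_add (hint _ _ _ _) (hint _ _ _ _),
      ← integral_add (hint _ _ _ _) (hint _ _ _ _),
      ← integral_sub (Integrable.fun_add (hint _ _ _ _) (hint _ _ _ _))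
        (Integrable.fun_add (hint _ _ _ _) (hint _ _ _ _))]
    refine integral_congr_ae (Filter.Eventually.of_forall fun l => ?_)
    simp only [F, H]
    ring
  have hS : ∑ a, ∑ t, ∑ b, ∑ c,
      (if a = 1 ∧ t = 1 then -1 else 1) * sgn b * sgn c * P a (a, b) (c, t) t =
      ∫ l, (α 0 l * γ 0 l + α 0 l * γ 1 l + α 1 l * γ 0 l - α 1 l * γ 1 l) ∂μ₁ := by
    rw [integral_sub (((hαγ _ _).fun_add (hαγ _ _)).fun_add (hαγ _ _)) (hαγ _ _),
      integral_add ((hαγ _ _).fun_add (hαγ _ _)) (hαγ _ _), integral_add (hαγ _ _) (hαγ _ _),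
      ← hE, ← hE, ← hE, ← hE]
    simp only [Fin.sum_univ_two, sgn_zero, sgn_one]
    norm_num
    ring
  rw [hS]
  calc _ ≤ ∫ _, 2 * ((∫ l, p 0 l ∂μ₀) * ∫ l, R 0 l ∂μ₂) ∂μ₁ :=
        integral_mono ((((hαγ _ _).add (hαγ _ _)).add (hαγ _ _)).sub (hαγ _ _))
          (integrable_const _) fun l => chsh_le (fun a => hα a l) (fun t => hγ t l)
    _ = 2 * C := by simp [hprod]

end LocalBound

/-! ### The inequality for chains of at least three sources. -/

section Chain

theorem measurePreserving_zero_succ {n : ℕ} {Λ : Fin (n + 1) → Type}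
    [∀ i, MeasurableSpace (Λ i)] (μ : ∀ i, Measure (Λ i)) [∀ i, SigmaFinite (μ i)] :
    MeasurePreserving (fun l : ∀ i, Λ i => (l 0, fun j : Fin n => l j.succ)) (Measure.pi μ)
      ((μ 0).prod (Measure.pi fun j : Fin n => μ j.succ)) :=
  measurePreserving_piFinSuccAbove μ 0

/-- The outputs `b` and `b'` of the first two middle parties, when all others output `(t, t)`. -/
def outputs (n : ℕ) (b b' : Fin 2 × Fin 2) (t : Fin 2) : Fin (n + 2) → Fin 2 × Fin 2 :=
  Fin.cons b (Fin.cons b' fun _ => (t, t))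

/-- A Bell inequality for the `n`-local correlations of a chain with at least three sources. -/
theorem IsNLocal.chsh {n : ℕ} {X Y : Type}
    {P : Behavior (n + 2) X Y (Fin 2) (Fin 2) (fun _ => Fin 2 × Fin 2)} (h : IsNLocal P)
    (x : X) (y : Y) {C : ℝ} (hC : 0 < C)
    (hPC : ∀ a t, ∑ b, ∑ b', P x y a (outputs n b b' t) t = C) :
    ∑ a, ∑ t, ∑ b, ∑ c, (if a = 1 ∧ t = 1 then -1 else 1) * sgn b * sgn c *
      P x y a (outputs n (a, b) (c, t) t) t ≤ 2 * C := by
  obtain ⟨Λ, mΛ, μ, hμ, p, q, r, hp, hq, hr, hpm, hqm, hrm, hP⟩ := h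
  -- All sources from the third on are merged into one hidden variable; `R t` is the probability
  -- that every party depending on these sources alone outputs `t` throughout.
  let R : Fin 2 → (∀ j : Fin (n + 1), Λ j.succ.succ) → ℝ := fun t l =>
    (∏ k : Fin n, q k.succ.succ (l k.castSucc) (l k.succ) (t, t)) * r y (l (Fin.last n)) t
  have hRm : ∀ t, Measurable (R t) := fun t => by
    refine Measurable.mul (Finset.measurable_prod _ fun k _ => ?_) ?_
    · have hpair : Measurable fun l : ∀ j : Fin (n + 1), Λ j.succ.succ =>
          ((l k.castSucc, l k.succ) : Λ k.succ.succ.castSucc × Λ k.succ.succ.succ) :=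
        (measurable_pi_apply (X := fun j : Fin (n + 1) => Λ j.succ.succ) k.castSucc).prodMk
          (measurable_pi_apply (X := fun j : Fin (n + 1) => Λ j.succ.succ) k.succ)
      exact (hqm k.succ.succ (t, t)).comp hpair
    · exact (hrm y t).comp (measurable_pi_apply (Fin.last n))
  have hR0 : ∀ t l, 0 ≤ R t l := fun t l =>
    mul_nonneg (Finset.prod_nonneg fun k _ => (hq _ _ _).1 _) ((hr _ _).1 _)
  have hR1 : ∀ t l, |R t l| ≤ 1 := fun t l => by
    refine abs_mul_le_one ?_ (abs_le_one_of_mem_stdSimplex (hr _ _) _)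
    rw [Finset.abs_prod]
    exact Finset.prod_le_one (fun _ _ => abs_nonneg _)
      fun _ _ => abs_le_one_of_mem_stdSimplex (hq _ _ _) _
  have hΦ : MeasurePreserving
      (fun l : ∀ i, Λ i => (l 0, l 1, fun j : Fin (n + 1) => l j.succ.succ)) (Measure.pi μ)
      ((μ 0).prod ((μ 1).prod (Measure.pi fun j : Fin (n + 1) => μ j.succ.succ))) :=
    ((MeasurePreserving.id (μ 0)).prod
      (measurePreserving_zero_succ fun j : Fin (n + 2) => μ j.succ)).comp
      (measurePreserving_zero_succ μ)
  refine chsh_chain (μ₀ := μ 0) (μ₁ := μ 1) (μ₂ := Measure.pi fun j : Fin (n + 1) => μ j.succ.succ)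
    (p := fun a l => p x l a) (q₀ := fun l l' => q 0 l l')
    (q₁ := fun l l' => q 1 l (l' 0)) (R := R)
    (P := fun a b b' t => P x y a (outputs n b b' t) t)
    (hpm x) (fun a l => (hp x l).1 a) (fun a l => abs_le_one_of_mem_stdSimplex (hp x l) a)
    (hqm 0) (hq 0) (fun b => ?_) (fun l l' => hq 1 l (l' 0)) hRm hR0 hR1 ?_ hC hPC
  · exact (hqm 1 b).comp (measurable_fst.prodMk ((measurable_pi_apply 0).comp measurable_snd))
  · intro a b b' t
    rw [hP, ← hΦ.map_eq, integral_map hΦ.measurable.aemeasurable]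
    · refine integral_congr_ae (Filter.Eventually.of_forall fun l => ?_)
      simp only [Fin.prod_univ_succ]
      change p x (l 0) a * (q 0 (l 0) (l 1) b * (q 1 (l 1) (l 2) b' *
        ∏ k : Fin n, q k.succ.succ (l k.succ.succ.castSucc) (l k.succ.succ.succ) (t, t))) *
        r y (l (Fin.last (n + 2))) t = p x (l 0) a * q 0 (l 0) (l 1) b * (q 1 (l 1) (l 2) b' *
        ((∏ k : Fin n, q k.succ.succ (l k.succ.succ.castSucc) (l k.succ.succ.succ) (t, t)) *
        r y (l (Fin.last (n + 2))) t))
      ring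
    · refine Measurable.aestronglyMeasurable (Measurable.mul (Measurable.mul ?_ ?_)
        (Measurable.mul ?_ ?_))
      · exact (hpm x a).comp measurable_fst
      · exact (hqm 0 b).comp (measurable_fst.prodMk (measurable_fst.comp measurable_snd))
      · exact (hqm 1 b').comp ((measurable_fst.comp measurable_snd).prodMk
          ((measurable_pi_apply 0).comp (measurable_snd.comp measurable_snd)))
      · exact (hRm t).comp (measurable_snd.comp measurable_snd)

end Chain

/-! ### Qubit measurements and the Bell state. -/

section Qubit

/-- The positive operator of trace one with Bloch vector `(x, 0, z)`. -/
def bloch (z x : ℝ) : Matrix (Fin 2) (Fin 2) ℂ :=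
  !![((1 + z) / 2 : ℂ), (x / 2 : ℂ); (x / 2 : ℂ), ((1 - z) / 2 : ℂ)]

/-- For a unit Bloch vector the operator is a Hermitian projection. -/
theorem bloch_posSemidef {z x : ℝ} (h : z ^ 2 + x ^ 2 = 1) : (bloch z x).PosSemidef := by
  have hc : (z : ℂ) ^ 2 + (x : ℂ) ^ 2 = 1 := by exact_mod_cast h
  have h2 : bloch z x = (bloch z x)ᴴ * bloch z x := by
    ext i j
    fin_cases i <;> fin_cases j <;>
      simp [bloch, Matrix.mul_apply, Fin.sum_univ_two, Complex.conj_ofNat] <;>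
      first | ring1 | linear_combination (-1 / 4 : ℂ) * hc
  rw [h2]
  exact posSemidef_conjTranspose_mul_self _

theorem sgn_mul_self (b : Fin 2) : sgn b * sgn b = 1 := by
  fin_cases b <;> simp

theorem sgn_sq (b : Fin 2) : sgn b ^ 2 = 1 := by rw [sq, sgn_mul_self]

/-- The projective measurement of a qubit along `±(x, 0, z)`. -/
def sharp (z x : ℝ) (h : z ^ 2 + x ^ 2 = 1) : POVM (Fin 2) (Fin 2) where
  effect b := bloch (sgn b * z) (sgn b * x)
  posSemidef b := bloch_posSemidef (by linear_combination (z ^ 2 + x ^ 2) * sgn_sq b + h)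
  sum_eq_one := by
    ext i j
    fin_cases i <;> fin_cases j <;> simp [bloch, Fin.sum_univ_two] <;> ring

/-- The measurement of a qubit in the computational basis. -/
def zBasis : POVM (Fin 2) (Fin 2) := sharp 1 0 (by norm_num)

theorem zBasis_effect (s i j : Fin 2) :
    zBasis.effect s i j = if i = s ∧ j = s then 1 else 0 := by
  fin_cases s <;> fin_cases i <;> fin_cases j <;> norm_num [zBasis, sharp, bloch]

/-- Classical randomized relabelling of the outcome of a measurement. -/
def POVM.relabel {k : ℕ} {O ι : Type} [Fintype O] [Fintype ι] [DecidableEq ι]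
    (G : POVM (Fin k) ι) (p : Fin k → O → ℝ) (hp : ∀ l, p l ∈ stdSimplex ℝ O) : POVM O ι where
  effect a := ∑ l, ((p l a : ℝ) : ℂ) • G.effect l
  posSemidef a := posSemidef_sum _ fun l _ =>
    (G.posSemidef l).smul (Complex.zero_le_real.2 ((hp l).1 a))
  sum_eq_one := by
    rw [Finset.sum_comm, ← G.sum_eq_one]
    refine Finset.sum_congr rfl fun l _ => ?_
    rw [← Finset.sum_smul, ← Complex.ofReal_sum, (hp l).2, Complex.ofReal_one, one_smul]

theorem compatible_relabel {k : ℕ} {X O ι : Type} [Fintype O] [Fintype ι] [DecidableEq ι]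
    (G : POVM (Fin k) ι) (p : X → Fin k → O → ℝ) (hp : ∀ x l, p x l ∈ stdSimplex ℝ O) :
    Compatible fun x => G.relabel (p x) (hp x) :=
  ⟨k, G, p, hp, fun _ _ => rfl⟩

theorem compatible_const {k : ℕ} {O ι : Type} [Fintype O] [Fintype ι] [DecidableEq ι]
    (e : O ≃ Fin k) (M : POVM O ι) : Compatible fun _ : Unit => M := by
  classical
  refine ⟨k, ⟨fun l => M.effect (e.symm l), fun l => M.posSemidef _, ?_⟩,
    fun _ l => Pi.single (e.symm l) 1, fun _ l => single_mem_stdSimplex ℝ _, fun _ a => ?_⟩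
  · rw [e.symm.sum_comp, M.sum_eq_one]
  · rw [Finset.sum_eq_single (e a)]
    · simp
    · intro l _ hl
      have ha : a ≠ e.symm l := fun h => hl (by rw [h, e.apply_symm_apply])
      simp only [Pi.single_eq_of_ne ha, Complex.ofReal_zero, zero_smul]
    · simp

/-- A joint measurement of an unsharp `Z` and an unsharp `X`. -/
def unsharpParent : POVM (Fin (2 * 2)) (Fin 2) where
  -- The rational unit vector `(4/5, 3/5)` makes all four effects rank one. Summing over the unread
  -- sign leaves sharpness 4/5 for `Z` and 3/5 for `X`, so the unsharp `Z` errs with probability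
  -- 1/10.
  effect l := (1 / 2 : ℂ) • bloch (4 / 5 * sgn (finProdFinEquiv.symm l).1)
    (3 / 5 * sgn (finProdFinEquiv.symm l).2)
  posSemidef l := (bloch_posSemidef (by
    linear_combination 16 / 25 * sgn_sq (finProdFinEquiv.symm l).1
      + 9 / 25 * sgn_sq (finProdFinEquiv.symm l).2)).smul (by norm_num [Complex.le_def])
  sum_eq_one := by
    rw [finProdFinEquiv.symm.sum_comp fun l : Fin 2 × Fin 2 =>
      (1 / 2 : ℂ) • bloch (4 / 5 * sgn l.1) (3 / 5 * sgn l.2), Fintype.sum_prod_type]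
    ext i j
    fin_cases i <;> fin_cases j <;> simp [bloch, Fin.sum_univ_two] <;> ring

/-- The outcomes of the two unsharp measurements, read off from the joint measurement. -/
def unsharpResponse (x : Fin 2) (l : Fin (2 * 2)) : Fin 2 → ℝ :=
  Pi.single (if x = 0 then (finProdFinEquiv.symm l).1 else (finProdFinEquiv.symm l).2) 1

/-- Two noncommuting compatible measurements: an unsharp `Z` for `x = 0` and an unsharp `X` for
`x = 1`. -/
def unsharp (x : Fin 2) : POVM (Fin 2) (Fin 2) :=
  unsharpParent.relabel (unsharpResponse x) fun _ => single_mem_stdSimplex ℝ _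

theorem unsharp_compatible : Compatible unsharp :=
  compatible_relabel unsharpParent unsharpResponse fun _ _ => single_mem_stdSimplex ℝ _

/-- The probability of outcome `a` of the unsharp `Z` in the basis state `i`. -/
def unsharpProb (a i : Fin 2) : ℝ := if i = a then 9 / 10 else 1 / 10

theorem unsharp_zero_effect (a i j : Fin 2) :
    (unsharp 0).effect a i j = if i = j then (unsharpProb a i : ℂ) else 0 := by
  have h : (unsharp 0).effect a = ∑ l : Fin 2 × Fin 2,
      (((Pi.single l.1 1 : Fin 2 → ℝ) a : ℝ) : ℂ) •
        ((1 / 2 : ℂ) • bloch (4 / 5 * sgn l.1) (3 / 5 * sgn l.2)) :=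
    finProdFinEquiv.symm.sum_comp fun l : Fin 2 × Fin 2 =>
      (((Pi.single l.1 1 : Fin 2 → ℝ) a : ℝ) : ℂ) •
        ((1 / 2 : ℂ) • bloch (4 / 5 * sgn l.1) (3 / 5 * sgn l.2))
  rw [h, Fintype.sum_prod_type]
  fin_cases a <;> fin_cases i <;> fin_cases j <;>
    simp [bloch, Fin.sum_univ_two, unsharpProb, Pi.single_apply] <;> norm_num

open scoped Kronecker

/-- Measure the left qubit in the computational basis, and use and announce the outcome as the
input of a measurement of the right qubit. -/
def controlLeft (M : Fin 2 → POVM (Fin 2) (Fin 2)) : POVM (Fin 2 × Fin 2) (Fin 2 × Fin 2) where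
  effect o := zBasis.effect o.1 ⊗ₖ (M o.1).effect o.2
  posSemidef o := (zBasis.posSemidef _).kronecker ((M _).posSemidef _)
  sum_eq_one := by
    rw [Fintype.sum_prod_type, ← Matrix.one_kronecker_one]
    have h : ∀ i j, ∑ s, zBasis.effect s i j = (1 : Matrix (Fin 2) (Fin 2) ℂ) i j := fun i j => by
      rw [← Matrix.sum_apply, zBasis.sum_eq_one]
    ext i j
    rw [Matrix.kroneckerMap_apply, ← h i.1 j.1]
    simp only [Matrix.sum_apply, Matrix.kroneckerMap_apply, Finset.sum_mul]
    refine Finset.sum_congr rfl fun s _ => ?_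
    rw [← Finset.mul_sum, ← Matrix.sum_apply, (M s).sum_eq_one]

/-- Measure the right qubit in the computational basis, and use and announce the outcome as the
input of a measurement of the left qubit. -/
def controlRight (M : Fin 2 → POVM (Fin 2) (Fin 2)) : POVM (Fin 2 × Fin 2) (Fin 2 × Fin 2) where
  effect o := (M o.2).effect o.1 ⊗ₖ zBasis.effect o.2
  posSemidef o := ((M _).posSemidef _).kronecker (zBasis.posSemidef _)
  sum_eq_one := by
    rw [Fintype.sum_prod_type_right, ← Matrix.one_kronecker_one]
    have h : ∀ i j, ∑ s, zBasis.effect s i j = (1 : Matrix (Fin 2) (Fin 2) ℂ) i j := fun i j => by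
      rw [← Matrix.sum_apply, zBasis.sum_eq_one]
    ext i j
    rw [Matrix.kroneckerMap_apply (i := i) (j := j), ← h i.2 j.2]
    simp only [Matrix.sum_apply, Matrix.kroneckerMap_apply, Finset.mul_sum]
    refine Finset.sum_congr rfl fun s _ => ?_
    rw [← Finset.sum_mul, ← Matrix.sum_apply, (M s).sum_eq_one]

/-- The maximally entangled state of two qubits. -/
def bell : DensityMatrix (Fin 2 × Fin 2) where
  mat := Matrix.of fun s t => if s.1 = s.2 ∧ t.1 = t.2 then 1 / 2 else 0
  posSemidef := by
    have h := (posSemidef_vecMulVec_self_star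
      fun s : Fin 2 × Fin 2 => if s.1 = s.2 then (1 : ℂ) else 0).smul
      (show (0 : ℂ) ≤ 1 / 2 by norm_num [Complex.le_def])
    refine (congrArg Matrix.PosSemidef ?_).mpr h
    ext s t
    by_cases hs : s.1 = s.2 <;> by_cases ht : t.1 = t.2 <;> simp [vecMulVec_apply, hs, ht]
  trace_eq_one := by
    simp [Matrix.trace, Fintype.sum_prod_type]

end Qubit

/-! ### The network violating the inequality. -/

section Chain

/-- Bell matrix entries vanish unless the two qubits agree in both indices, so each source keeps one
row bit and one column bit, seen by both of its neighbours, and a factor 1/2. -/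
theorem trace_globalEffect_mul_bell {m : ℕ} {X Y OA OC : Type} {OB : Fin m → Type}
    [Fintype OA] [Fintype OC] [∀ k, Fintype (OB k)]
    (N : LinearNetwork m (fun _ => 2) (fun _ => 2) X Y OA OC OB) (hN : ∀ i, N.state i = bell)
    (x : X) (y : Y) (a : OA) (b : ∀ k, OB k) (c : OC) :
    (N.globalEffect x y a b c * N.globalState).trace = ∑ u : Fin (m + 1) → Fin 2,
      ∑ v : Fin (m + 1) → Fin 2, N.globalEffect x y a b c (fun i => (u i, u i))
        (fun i => (v i, v i)) * (1 / 2) ^ (m + 1) := by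
  have hinj : Function.Injective fun (u : Fin (m + 1) → Fin 2) (i : Fin (m + 1)) => (u i, u i) :=
    fun u v h => funext fun i => (Prod.ext_iff.1 (congrFun h i)).1
  have hrange : ∀ s : Fin (m + 1) → Fin 2 × Fin 2,
      s ∉ Set.range (fun (u : Fin (m + 1) → Fin 2) (i : Fin (m + 1)) => (u i, u i)) →
      ∃ i, (s i).1 ≠ (s i).2 := by
    intro s hs
    by_contra! h
    exact hs ⟨fun i => (s i).1, funext fun i => Prod.ext rfl (h i)⟩
  have hstate : ∀ s t, N.globalState s t =
      ∏ i, if (s i).1 = (s i).2 ∧ (t i).1 = (t i).2 then (1 / 2 : ℂ) else 0 := by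
    intro s t
    simp only [LinearNetwork.globalState, Matrix.of_apply, hN, bell]
  simp only [Matrix.trace, Matrix.diag_apply, Matrix.mul_apply]
  symm
  refine Fintype.sum_of_injective _ hinj _ _ (fun s hs => ?_) fun u => ?_
  · obtain ⟨i, hi⟩ := hrange s hs
    refine Finset.sum_eq_zero fun t _ => ?_
    rw [hstate, Finset.prod_eq_zero (Finset.mem_univ i) (by simp [hi]), mul_zero]
  · refine Fintype.sum_of_injective _ hinj _ _ (fun s hs => ?_) fun v => ?_
    · obtain ⟨i, hi⟩ := hrange s hs
      rw [hstate, Finset.prod_eq_zero (Finset.mem_univ i) (by simp [hi]), mul_zero]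
    · rw [hstate]
      simp

theorem sum_sum_cons {k : ℕ} {M : Type*} [AddCommMonoid M]
    (f : (Fin (k + 1) → Fin 2) → (Fin (k + 1) → Fin 2) → M) :
    ∑ u, ∑ v, f u v = ∑ i : Fin 2, ∑ j : Fin 2, ∑ u : Fin k → Fin 2, ∑ v : Fin k → Fin 2,
      f (Fin.cons i u) (Fin.cons j v) := by
  have h : ∀ g : (Fin (k + 1) → Fin 2) → M,
      ∑ u, g u = ∑ i : Fin 2, ∑ u : Fin k → Fin 2, g (Fin.cons i u) := fun g => by
    rw [← (Fin.consEquiv fun _ : Fin (k + 1) => Fin 2).sum_comp, Fintype.sum_prod_type]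
    rfl
  rw [h]
  refine Finset.sum_congr rfl fun i _ => ?_
  simp_rw [h]
  rw [Finset.sum_comm]

/-- The measurement directions of the first middle party. -/
def leftSetting (s : Fin 2) : POVM (Fin 2) (Fin 2) :=
  sharp (if s = 0 then 1 else 0) (if s = 0 then 0 else 1) (by split_ifs <;> norm_num)

/-- The measurement directions of the second middle party. -/
def rightSetting (t : Fin 2) : POVM (Fin 2) (Fin 2) :=
  sharp (4 / 5) (3 / 5 * sgn t) (by linear_combination 9 / 25 * sgn_sq t)

/-- A chain of maximally entangled pairs, in which the first two middle parties perform a CHSH test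
on the second pair, with inputs that they obtain from, and share with, their other neighbours. -/
def chshNetwork (n : ℕ) : LinearNetwork (n + 2) (fun _ => 2) (fun _ => 2) (Fin 2) (Fin 2) (Fin 2)
    (Fin 2) (fun _ => Fin 2 × Fin 2) where
  state _ := bell
  first := unsharp
  middle := Fin.cons (controlLeft leftSetting) (Fin.cons (controlRight rightSetting)
    fun _ => controlLeft fun _ => zBasis)
  last := unsharp

/-- The effect of the output `t` of the parties to the right of the third source. -/
def tailEffect (n : ℕ) (t : Fin 2) (u v : Fin (n + 1) → Fin 2) : ℂ :=
  (∏ k : Fin n, zBasis.effect t (u k.castSucc) (v k.castSucc) * zBasis.effect t (u k.succ) (v k.succ))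
    * (unsharp 0).effect t (u (Fin.last n)) (v (Fin.last n))

/-- The probability of the outputs `t` of the parties to the right of the third source when the
second middle party finds `t'`. -/
def tailProb (n : ℕ) (t t' : Fin 2) : ℝ :=
  if n = 0 then unsharpProb t t' else if t = t' then 9 / 10 else 0

/-- For `n > 0` the sharp measurements in between kill every configuration except the constant `t`,
leaving only the last party's noise. For `n = 0` the last party shares its source with the second
middle party, and a mismatch has weight 1/10. -/
theorem sum_tailEffect (n : ℕ) (t t' : Fin 2) :
    ∑ u, ∑ v, zBasis.effect t' (u 0) (v 0) * tailEffect n t u v = (tailProb n t t' : ℂ) := by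
  rcases n with _ | n
  · rw [sum_sum_cons]
    simp only [tailEffect, tailProb, zBasis_effect, unsharp_zero_effect, Fin.sum_univ_two]
    fin_cases t' <;> simp
  · have h0 : ∀ u v : Fin (n + 2) → Fin 2, (u ≠ (fun _ => t) ∨ v ≠ fun _ => t) →
        tailEffect (n + 1) t u v = 0 := by
      intro u v h
      obtain ⟨i, hi⟩ : ∃ i, ¬ (u i = t ∧ v i = t) := by
        by_contra! hc
        rcases h with h | h
        · exact h (funext fun i => (hc i).1)
        · exact h (funext fun i => (hc i).2)
      have : ∃ k : Fin (n + 1), zBasis.effect t (u k.castSucc) (v k.castSucc) *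
          zBasis.effect t (u k.succ) (v k.succ) = 0 := by
        rcases i.eq_castSucc_or_eq_last with ⟨k, rfl⟩ | rfl
        · exact ⟨k, by rw [zBasis_effect, if_neg hi, zero_mul]⟩
        · refine ⟨Fin.last n, ?_⟩
          rw [Fin.succ_last, zBasis_effect _ (u (Fin.last _)), if_neg hi, mul_zero]
      obtain ⟨k, hk⟩ := this
      rw [tailEffect, Finset.prod_eq_zero (Finset.mem_univ k) hk, zero_mul]
    rw [Finset.sum_eq_single fun _ => t, Finset.sum_eq_single fun _ => t]
    · by_cases h : t = t' <;>
        simp [tailEffect, tailProb, zBasis_effect, unsharp_zero_effect, unsharpProb, h]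
    · intro v _ hv
      rw [h0 _ _ (Or.inr hv), mul_zero]
    · simp
    · intro u _ hu
      exact Finset.sum_eq_zero fun v _ => by rw [h0 _ _ (Or.inl hu), mul_zero]
    · simp

/-- The correlator of the two parties of the CHSH test. -/
def chshCorrelator (s t : Fin 2) : ℝ := if s = 0 then 4 / 5 else 3 / 5 * sgn t

/-- The matrices are real symmetric, so the sum is the trace of their product, `(1 + v ⬝ w) / 2` for
Bloch vectors `v`, `w`; `chshCorrelator` is the inner product of the directions. -/
theorem sum_settings (s t b c : Fin 2) :
    ∑ i, ∑ j, (leftSetting s).effect b i j * (rightSetting t).effect c i j =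
      (((1 + sgn b * sgn c * chshCorrelator s t) / 2 : ℝ) : ℂ) := by
  simp only [Fin.sum_univ_two, leftSetting, rightSetting, sharp, bloch, chshCorrelator]
  fin_cases s <;> simp <;> ring

theorem sum_head (a s : Fin 2) :
    ∑ i, ∑ j, (unsharp 0).effect a i j * zBasis.effect s i j = (unsharpProb a s : ℂ) := by
  simp only [Fin.sum_univ_two, zBasis_effect, unsharp_zero_effect]
  fin_cases s <;> simp

theorem chshNetwork_correlation (n : ℕ) (a s b c t' t : Fin 2) :
    (chshNetwork n).correlation 0 0 a (outputs n (s, b) (c, t') t) t =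
      (1 / 2) ^ (n + 3) * (unsharpProb a s * ((1 + sgn b * sgn c * chshCorrelator s t') / 2)
        * tailProb n t t') := by
  have hterm : ∀ (u₀ v₀ u₁ v₁ : Fin 2) (u v : Fin (n + 1) → Fin 2),
      (chshNetwork n).globalEffect 0 0 a (outputs n (s, b) (c, t') t) t
        (fun i => ((Fin.cons u₀ (Fin.cons u₁ u : Fin (n + 2) → Fin 2) : Fin (n + 3) → Fin 2) i,
          (Fin.cons u₀ (Fin.cons u₁ u : Fin (n + 2) → Fin 2) : Fin (n + 3) → Fin 2) i))
        (fun i => ((Fin.cons v₀ (Fin.cons v₁ v : Fin (n + 2) → Fin 2) : Fin (n + 3) → Fin 2) i,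
          (Fin.cons v₀ (Fin.cons v₁ v : Fin (n + 2) → Fin 2) : Fin (n + 3) → Fin 2) i)) =
      ((unsharp 0).effect a u₀ v₀ * zBasis.effect s u₀ v₀) *
        (((leftSetting s).effect b u₁ v₁ * (rightSetting t').effect c u₁ v₁) *
          (zBasis.effect t' (u 0) (v 0) * tailEffect n t u v)) := by
    intro u₀ v₀ u₁ v₁ u v
    simp only [LinearNetwork.globalEffect, Matrix.of_apply, Fin.prod_univ_succ]
    change (unsharp 0).effect a u₀ v₀ * ((zBasis.effect s u₀ v₀ * (leftSetting s).effect b u₁ v₁) *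
      (((rightSetting t').effect c u₁ v₁ * zBasis.effect t' (u 0) (v 0)) *
      ∏ k : Fin n, zBasis.effect t (u k.castSucc) (v k.castSucc)
        * zBasis.effect t (u k.succ) (v k.succ))) *
      (unsharp 0).effect t (u (Fin.last n)) (v (Fin.last n)) = _
    rw [tailEffect]
    ring
  rw [LinearNetwork.correlation, trace_globalEffect_mul_bell _ fun _ => rfl, sum_sum_cons]
  simp_rw [sum_sum_cons (k := n + 1), hterm, ← Finset.sum_mul, ← Finset.mul_sum, sum_tailEffect,
    ← Finset.sum_mul, sum_settings, sum_head]
  rw [show ((1 / 2 : ℂ)) ^ (n + 2 + 1) = (((1 / 2) ^ (n + 3) : ℝ) : ℂ) by push_cast; rfl]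
  rw [← Complex.ofReal_mul, ← Complex.ofReal_mul, ← Complex.ofReal_mul, Complex.ofReal_re]
  ring

theorem chshNetwork_not_isNLocal (n : ℕ) : ¬ IsNLocal (chshNetwork n).correlation := by
  intro h
  have hK : (0 : ℝ) < (1 / 2) ^ (n + 3) := by positivity
  have hσ : ∀ t, ∑ t', tailProb n t t' = if n = 0 then 1 else 9 / 10 := by
    intro t
    rw [Fin.sum_univ_two]
    fin_cases t <;> by_cases hn : n = 0 <;> simp [tailProb, unsharpProb, hn] <;> norm_num
  have hdiag : ∀ t, tailProb n t t = 9 / 10 := fun t => by simp [tailProb, unsharpProb]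
  have hσ0 : (0 : ℝ) < if n = 0 then 1 else 9 / 10 := by split_ifs <;> norm_num
  -- In `C`, the factor 2 is the sum of `(1 + sgn b * sgn c * E) / 2` over `b` and `c`, for any
  -- correlator `E`; the last factor is the total weight of the tail.
  have key := h.chsh 0 0 (C := (1 / 2) ^ (n + 3) * (2 * if n = 0 then 1 else 9 / 10))
    (by positivity) fun a t => by
      rw [← hσ t]
      simp_rw [Fintype.sum_prod_type, chshNetwork_correlation]
      simp only [Fin.sum_univ_two, sgn_zero, sgn_one]
      fin_cases a <;> simp [unsharpProb] <;> ring
  simp_rw [chshNetwork_correlation, hdiag] at key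
  simp only [Fin.sum_univ_two, sgn_zero, sgn_one, chshCorrelator, unsharpProb] at key
  norm_num at key
  -- The correlators add up to 14/5, so after normalization the bound 2 is exceeded by `14/5 *
  -- (9/10)^2` for `n = 0` and by `14/5 * (9/10)` otherwise.
  split_ifs at key <;> linarith

end Chain

end NLocal

end

theorem theorem3 :
    -- `n ≥ 3` sources, `n = m + 1`: two-qubit sources, two dichotomic inputs at each end,
    -- one four-outcome measurement at each middle party
    (∀ m : ℕ, 3 ≤ m + 1 →
      ∃ N : NLocal.LinearNetwork m (fun _ => 2) (fun _ => 2) (Fin 2) (Fin 2) (Fin 2) (Fin 2)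
          (fun _ => Fin 2 × Fin 2),
        NLocal.Compatible N.first ∧
        (∀ k, NLocal.Compatible fun _ : Unit => N.middle k) ∧
        NLocal.Compatible N.last ∧
        ¬ NLocal.IsNLocal N.correlation) ∧
    -- `n = 2` sources, `m = 1`
    (∀ (dL dR : Fin 2 → ℕ) (X Y OA OC : Type) (OB : Fin 1 → Type)
        [Finite X] [Finite Y] [Fintype OA] [Fintype OC] [∀ k, Fintype (OB k)]
        (N : NLocal.LinearNetwork 1 dL dR X Y OA OC OB),
        NLocal.Compatible N.first → NLocal.Compatible N.last →
        NLocal.IsFinitelyNLocal N.correlation) := by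
  refine ⟨fun m hm => ?_, fun dL dR X Y OA OC OB _ _ _ _ _ N hA hC =>
    N.isFinitelyNLocal_of_compatible hA hC⟩
  -- `n` counts the middle parties beyond the two that perform the CHSH test.
  obtain ⟨n, rfl⟩ : ∃ n, m = n + 2 := ⟨m - 2, by omega⟩
  exact ⟨NLocal.chshNetwork n, NLocal.unsharp_compatible,
    fun k => NLocal.compatible_const finProdFinEquiv _, NLocal.unsharp_compatible,
    NLocal.chshNetwork_not_isNLocal n⟩
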